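/- **Theorem 47 (an uncountable computability structure).** The axioms of Pour-El and Richards for a computability structure on a Banach space allow uncountably many computable elements. Here a *computability structure* on a complex Banach space $E$ is a non-empty set $S$ of sequences in $E$ (the "computable sequences") such that: (i) if $(x_n),(y_n)\in S$, $(\alpha_{nk}),(\beta_{nk})$ are computable double sequences of complex numbers and $d:\mathbb N\to\mathbb N$ is recursive, then $\big(\sum_{k=0}^{d(n)}(\alpha_{nk}x_k+\beta_{nk}y_k)\big)_n\in S$; (ii) if the double sequence $(x_{nk})$, read as a single sequence through a recursive pairing, is in $S$ and $x_{nk}\to y_n$ as $k\to\infty$, effectively in $k$ and $n$, then $(y_n)\in S$; (iii) if $(x_n)\in S$, then $(\|x_n\|)$ is a computable sequence of real numbers. An element $x$ is *computable* if the constant sequence $(x,x,\dots)$ is in $S$. More precisely, let $X$ be the Hilbert space of almost periodic functions, i.e. the completion of the space of uniform limits of trigonometric polynomials $\sum_j c_j e^{i\lambda_j t}$ ($\lambda_j\in\mathbb R$) for the norm $\|f\|^2=\lim_{T\to\infty}\frac1T\int_0^T|f(t)|^2\,dt$. Then: 1. $X$ is non-separable, and $\{e^{i\lambda t}\}_{\lambda\in\mathbb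 R}$ is an orthonormal basis of $X$ (an orthonormal family with dense linear span). 2. For every non-empty orthonormal set $s\subseteq X$, let $P_v$ ($v\in s$) be the orthogonal projection of $X$ onto the line $\mathbb C v$. The closure of the constant sequences $(P_v,P_v,\dots)$, $v\in s$, under computable linear combinations (i) and effective limits (ii) is a computability structure on the Banach space $\operatorname{B}(X)$ of bounded operators with the operator norm; in particular it satisfies the norm axiom (iii). 3. In particular, for the basis $\{e^{i\lambda t}\}_{\lambda\in\mathbb R}$ the closure of the rank-one projections onto the lines $\mathbb C e^{i\lambda t}$, $\lambda\in\mathbb R$, is a computability structure on $\operatorname{B}(X)$; each of these projections is a computable element of it, and its set of computable elements is uncountable. -/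

import Mathlib

open Filter Topology

noncomputable section

/-! ## Computable sequences of numbers -/

/-- A sequence of rationals is computable if `q n = (-1)^(s n) * a n / b n` for recursive
functions `s`, `a`, `b` from `ℕ` to `ℕ`, where `b` never vanishes. -/
def ComputableRatSeq (q : ℕ → ℚ) : Prop :=
  ∃ s a b : ℕ → ℕ, Computable s ∧ Computable a ∧ Computable b ∧
    ∀ n, b n ≠ 0 ∧ q n = (-1) ^ s n * (a n : ℚ) / (b n : ℚ)

/-- The double sequence `x n k` converges to `y n` as `k → ∞`, effectively in `k` and `n`:
a recursive `e n N` bounds the `k` from which on the error is at most `2 ^ (-N)`. -/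
def EffectivelyTendsto {E : Type*} [PseudoMetricSpace E] (x : ℕ → ℕ → E) (y : ℕ → E) : Prop :=
  ∃ e : ℕ → ℕ → ℕ, Computable₂ e ∧
    ∀ n N k, e n N ≤ k → dist (x n k) (y n) ≤ (1 / 2 : ℝ) ^ N

/-- A double sequence, read as a single sequence by means of the recursive pairing function. -/
def flatten {A : Type*} (x : ℕ → ℕ → A) : ℕ → A := fun m => x m.unpair.1 m.unpair.2

/-- A sequence of reals is computable if it is the effective limit of a computable double
sequence of rationals. -/
def ComputableRealSeq (x : ℕ → ℝ) : Prop :=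
  ∃ q : ℕ → ℕ → ℚ, ComputableRatSeq (flatten q) ∧
    EffectivelyTendsto (fun n k => (q n k : ℝ)) x

/-- A sequence of complex numbers is computable if its real and imaginary parts are. -/
def ComputableComplexSeq (z : ℕ → ℂ) : Prop :=
  ComputableRealSeq (fun n => (z n).re) ∧ ComputableRealSeq (fun n => (z n).im)

/-! ## Computability structures on Banach spaces -/

/-- The axioms for a set `S` of sequences (the "computable sequences") to be a computability
structure on the complex Banach space `E`. -/
structure IsComputabilityStructure {E : Type*} [NormedAddCommGroup E] [NormedSpace ℂ E]
    [CompleteSpace E] (S : Set (ℕ → E)) : Prop where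
  /-- There is a computable sequence. -/
  nonempty : S.Nonempty
  /-- Closure under computable linear combinations. -/
  linear_combination : ∀ x ∈ S, ∀ y ∈ S, ∀ α β : ℕ → ℕ → ℂ,
    ComputableComplexSeq (flatten α) → ComputableComplexSeq (flatten β) →
    ∀ d : ℕ → ℕ, Computable d →
      (fun n => ∑ k ∈ Finset.range (d n + 1), (α n k • x k + β n k • y k)) ∈ S
  /-- Closure under effective limits of computable double sequences. -/
  limit : ∀ x : ℕ → ℕ → E, flatten x ∈ S → ∀ y : ℕ → E, EffectivelyTendsto x y → y ∈ S
  /-- The norms of a computable sequence form a computable sequence of reals. -/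
  norm : ∀ x ∈ S, ComputableRealSeq (fun n => ‖x n‖)

/-- The computable elements: those whose constant sequence is computable. -/
def computableElements {E : Type*} (S : Set (ℕ → E)) : Set E := {x | (fun _ => x) ∈ S}

/-- The closure of a set `G` of elements (each taken as a constant sequence) under computable
linear combinations and effective limits. -/
inductive GeneratedSeq {E : Type*} [NormedAddCommGroup E] [NormedSpace ℂ E] (G : Set E) :
    (ℕ → E) → Prop
  | const (g : E) (hg : g ∈ G) : GeneratedSeq G (fun _ => g)
  | linear_combination (x y : ℕ → E) (hx : GeneratedSeq G x) (hy : GeneratedSeq G y)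
      (α β : ℕ → ℕ → ℂ) (hα : ComputableComplexSeq (flatten α))
      (hβ : ComputableComplexSeq (flatten β)) (d : ℕ → ℕ) (hd : Computable d) :
      GeneratedSeq G (fun n => ∑ k ∈ Finset.range (d n + 1), (α n k • x k + β n k • y k))
  | limit (x : ℕ → ℕ → E) (hx : GeneratedSeq G (flatten x)) (y : ℕ → E)
      (hy : EffectivelyTendsto x y) : GeneratedSeq G y

/-- The set of sequences generated by `G`. -/
def generatedStructure {E : Type*} [NormedAddCommGroup E] [NormedSpace ℂ E] (G : Set E) :
    Set (ℕ → E) := {x | GeneratedSeq G x}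

/-! ## The Hilbert space of almost periodic functions -/

/-- The exponential `t ↦ e^{i lam t}` as a bounded continuous function. -/
def expFun (lam : ℝ) : BoundedContinuousFunction ℝ ℂ :=
  BoundedContinuousFunction.ofNormedAddCommGroup
    (fun t : ℝ => Complex.exp (((lam * t : ℝ) : ℂ) * Complex.I)) (by fun_prop) 1
    (fun t => (Complex.norm_exp_ofReal_mul_I (lam * t)).le)

/-- The average of `f` over `[0, T]`. -/
def avg (f : ℝ → ℂ) (T : ℝ) : ℂ := ((T⁻¹ : ℝ) : ℂ) * ∫ t in (0 : ℝ)..T, f t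

/-- The (Bohr) almost periodic functions: the uniform limits of trigonometric polynomials. -/
def almostPeriodic : Submodule ℂ (BoundedContinuousFunction ℝ ℂ) :=
  (Submodule.span ℂ (Set.range expFun)).topologicalClosure

theorem avg_add (f g : BoundedContinuousFunction ℝ ℂ) (T : ℝ) :
    avg (f + g : BoundedContinuousFunction ℝ ℂ) T = avg f T + avg g T := by
  simp only [avg, BoundedContinuousFunction.coe_add, Pi.add_apply]
  rw [intervalIntegral.integral_add (f.continuous.intervalIntegrable _ _)
    (g.continuous.intervalIntegrable _ _), mul_add]

theorem avg_smul (c : ℂ) (f : ℝ → ℂ) (T : ℝ) :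
    avg (fun t => c * f t) T = c * avg f T := by
  simp only [avg]
  rw [intervalIntegral.integral_const_mul]
  ring

theorem norm_avg_le {f : ℝ → ℂ} {C : ℝ} (h : ∀ t, ‖f t‖ ≤ C) {T : ℝ} (hT : 0 < T) :
    ‖avg f T‖ ≤ C := by
  have h1 := intervalIntegral.norm_integral_le_of_norm_le_const (a := 0) (b := T) (C := C)
    (f := f) (fun x _ => h x)
  rw [avg, norm_mul, Complex.norm_real, norm_inv, Real.norm_of_nonneg hT.le]
  rw [sub_zero, abs_of_pos hT] at h1
  calc T⁻¹ * ‖∫ t in (0 : ℝ)..T, f t‖ ≤ T⁻¹ * (C * T) := by gcongr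
    _ = C := by field_simp

theorem tendsto_avg_exp (lam : ℝ) : ∃ m, Tendsto (avg (expFun lam)) atTop (𝓝 m) := by
  by_cases hl : lam = 0
  · subst hl
    refine ⟨1, (tendsto_const_nhds (x := (1 : ℂ))).congr' ?_⟩
    filter_upwards [eventually_gt_atTop 0] with T hT
    have : (T : ℂ) ≠ 0 := by exact_mod_cast hT.ne'
    simp [avg, expFun, this]
  · refine ⟨0, ?_⟩
    have hc : (lam : ℂ) * Complex.I ≠ 0 := by simp [hl]
    have key : ∀ T, avg (expFun lam) T = ((T⁻¹ : ℝ) : ℂ) *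
        ((Complex.exp (lam * Complex.I * T) - 1) / (lam * Complex.I)) := by
      intro T
      have := integral_exp_mul_complex (a := 0) (b := T) hc
      simp only [Complex.ofReal_zero, mul_zero, Complex.exp_zero] at this
      rw [avg, ← this]
      congr 1
      refine intervalIntegral.integral_congr fun t _ => ?_
      simp only [expFun, BoundedContinuousFunction.coe_ofNormedAddCommGroup]
      congr 1
      push_cast
      ring
    rw [tendsto_zero_iff_norm_tendsto_zero]
    have h0 : Tendsto (fun T : ℝ => T⁻¹ * (2 / |lam|)) atTop (𝓝 0) := by
      simpa using tendsto_inv_atTop_zero.mul_const (2 / |lam|)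
    refine squeeze_zero' (Eventually.of_forall fun _ => norm_nonneg _) ?_ h0
    filter_upwards [eventually_gt_atTop 0] with T hT
    rw [key, norm_mul, Complex.norm_real, norm_inv, Real.norm_of_nonneg hT.le, norm_div]
    have h1 : ‖(lam : ℂ) * Complex.I‖ = |lam| := by simp
    have h2 : ‖Complex.exp (lam * Complex.I * T) - 1‖ ≤ 2 := by
      refine (norm_sub_le _ _).trans ?_
      have : (lam : ℂ) * Complex.I * T = ((lam * T : ℝ) : ℂ) * Complex.I := by
        push_cast; ring
      rw [this, Complex.norm_exp_ofReal_mul_I, norm_one]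
      norm_num
    rw [h1]
    gcongr

/-- Almost periodic functions have a mean value. -/
theorem tendsto_avg {f : BoundedContinuousFunction ℝ ℂ} (hf : f ∈ almostPeriodic) :
    ∃ m, Tendsto (avg f) atTop (𝓝 m) := by
  have hspan : ∀ g ∈ Submodule.span ℂ (Set.range expFun),
      ∃ m, Tendsto (avg (g : ℝ → ℂ)) atTop (𝓝 m) := by
    intro g hg
    induction hg using Submodule.span_induction with
    | mem g hg => obtain ⟨l, rfl⟩ := hg; exact tendsto_avg_exp l
    | zero =>
      refine ⟨0, (tendsto_const_nhds (x := (0 : ℂ))).congr fun T => ?_⟩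
      simp [avg]
    | add g h _ _ ihg ihh =>
      obtain ⟨a, ha⟩ := ihg
      obtain ⟨b, hb⟩ := ihh
      exact ⟨a + b, (ha.add hb).congr fun T => (avg_add g h T).symm⟩
    | smul c g _ ihg =>
      obtain ⟨a, ha⟩ := ihg
      exact ⟨c * a, (ha.const_mul c).congr fun T => (avg_smul c g T).symm⟩
  apply cauchySeq_tendsto_of_complete
  rw [Metric.cauchySeq_iff]
  intro ε hε
  obtain ⟨g, hg, hfg⟩ := Metric.mem_closure_iff.1 hf (ε / 3) (by positivity)
  obtain ⟨m, hm⟩ := hspan g hg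
  obtain ⟨N, hN⟩ := Metric.cauchySeq_iff.1 hm.cauchySeq (ε / 3) (by positivity)
  have hd : ∀ T : ℝ, 0 < T → dist (avg f T) (avg g T) ≤ dist f g := by
    intro T hT
    have h1 := avg_add (f - g) g T
    rw [sub_add_cancel] at h1
    rw [h1, dist_eq_norm, add_sub_cancel_right, dist_eq_norm]
    exact norm_avg_le (fun t => (f - g).norm_coe_le_norm t) hT
  refine ⟨max N 1, fun S hS T hT => ?_⟩
  have hS0 : 0 < S := lt_of_lt_of_le one_pos ((le_max_right _ _).trans hS)
  have hT0 : 0 < T := lt_of_lt_of_le one_pos ((le_max_right _ _).trans hT)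
  have h1 := hd S hS0
  have h2 := hd T hT0
  have h3 := hN S ((le_max_left _ _).trans hS) T ((le_max_left _ _).trans hT)
  rw [dist_comm] at h2
  linarith [dist_triangle4 (avg f S) (avg g S) (avg g T) (avg f T)]

theorem star_mul_mem_almostPeriodic {f g : BoundedContinuousFunction ℝ ℂ}
    (hf : f ∈ almostPeriodic) (hg : g ∈ almostPeriodic) : star f * g ∈ almostPeriodic := by
  have hcont : Continuous (Function.uncurry
      fun f g : BoundedContinuousFunction ℝ ℂ => star f * g) := by
    simp only [Function.uncurry_def]
    fun_prop
  refine map_mem_closure₂ (f := fun f g : BoundedContinuousFunction ℝ ℂ => star f * g)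
    hcont hf hg fun a ha b hb => ?_
  rw [SetLike.mem_coe] at ha hb
  have hexp : ∀ l m, star (expFun l) * expFun m = expFun (m - l) := by
    intro l m
    ext t
    simp only [expFun, BoundedContinuousFunction.coe_mul, BoundedContinuousFunction.coe_star,
      Pi.mul_apply, Pi.star_apply, BoundedContinuousFunction.coe_ofNormedAddCommGroup]
    rw [Complex.star_def, ← Complex.exp_conj, ← Complex.exp_add]
    congr 1
    simp
    ring
  induction ha using Submodule.span_induction with
  | mem a ha =>
    obtain ⟨l, rfl⟩ := ha
    induction hb using Submodule.span_induction with
    | mem b hb =>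
      obtain ⟨m, rfl⟩ := hb
      rw [hexp]
      exact Submodule.subset_span ⟨_, rfl⟩
    | zero => simp
    | add x y _ _ hx hy => rw [mul_add]; exact add_mem hx hy
    | smul c x _ hx => rw [mul_smul_comm]; exact Submodule.smul_mem _ _ hx
  | zero => simp
  | add x y _ _ hx hy => rw [star_add, add_mul]; exact add_mem hx hy
  | smul c x _ hx => rw [star_smul, smul_mul_assoc]; exact Submodule.smul_mem _ _ hx

/-- The space of almost periodic functions, as a type that does not carry the sup norm. -/
def AP : Type := almostPeriodic

instance : AddCommGroup AP := inferInstanceAs (AddCommGroup almostPeriodic)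
instance : Module ℂ AP := inferInstanceAs (Module ℂ almostPeriodic)
instance : CoeFun AP (fun _ => ℝ → ℂ) := ⟨fun f => f.1⟩

/-- `lim_{T → ∞} (1 / T) ∫₀ᵀ conj (f t) * g t dt`. -/
def meanInner (f g : AP) : ℂ :=
  limUnder atTop (avg fun t => starRingEnd ℂ (f t) * g t)

/-- The limit in the definition of `meanInner` exists. -/
theorem tendsto_meanInner (f g : AP) :
    Tendsto (avg fun t => starRingEnd ℂ (f t) * g t) atTop (𝓝 (meanInner f g)) :=
  tendsto_nhds_limUnder (tendsto_avg (star_mul_mem_almostPeriodic f.2 g.2))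

/-- The mean inner product is a positive semidefinite Hermitian form. -/
@[reducible]
def apCore : PreInnerProductSpace.Core ℂ AP where
  inner := meanInner
  conj_inner_symm f g := by
    refine tendsto_nhds_unique
      ((Complex.continuous_conj.tendsto _).comp (tendsto_meanInner g f)) ?_
    refine (tendsto_meanInner f g).congr fun T => ?_
    simp only [avg, Function.comp_apply, map_mul, Complex.conj_ofReal]
    rw [← intervalIntegral.intervalIntegral_conj]
    simp [mul_comm]
  re_inner_nonneg f := by
    refine ge_of_tendsto ((Complex.continuous_re.tendsto _).comp (tendsto_meanInner f f)) ?_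
    filter_upwards [eventually_gt_atTop 0] with T hT
    have h : ∀ t : ℝ, starRingEnd ℂ (f t) * f t = ((‖f t‖ ^ 2 : ℝ) : ℂ) := fun t => by
      rw [Complex.conj_mul']; push_cast; rfl
    simp only [Function.comp_apply, avg, h]
    rw [intervalIntegral.integral_ofReal, ← Complex.ofReal_mul, Complex.ofReal_re]
    exact mul_nonneg (inv_nonneg.2 hT.le)
      (intervalIntegral.integral_nonneg hT.le fun t _ => by positivity)
  add_left f g h := by
    refine tendsto_nhds_unique (tendsto_meanInner (f + g) h) ?_
    refine ((tendsto_meanInner f h).add (tendsto_meanInner g h)).congr fun T => ?_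
    have key := avg_add (star f.1 * h.1) (star g.1 * h.1) T
    rw [← add_mul, ← star_add] at key
    exact key.symm
  smul_left f g c := by
    refine tendsto_nhds_unique (tendsto_meanInner (c • f) g) ?_
    refine ((tendsto_meanInner f g).const_mul (starRingEnd ℂ c)).congr fun T => ?_
    rw [← avg_smul]
    congr 1
    funext t
    have : (c • f) t = c * f t := rfl
    rw [this, map_mul, mul_assoc]

instance : SeminormedAddCommGroup AP :=
  @InnerProductSpace.Core.toSeminormedAddCommGroup ℂ AP _ _ _ apCore
instance : InnerProductSpace ℂ AP := InnerProductSpace.ofCore apCore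

/-- The norm of `AP` is the mean square norm: `‖f‖² = lim_{T → ∞} (1 / T) ∫₀ᵀ |f t|² dt`. -/
theorem AP.tendsto_norm_sq (f : AP) :
    Tendsto (fun T : ℝ => T⁻¹ * ∫ t in (0 : ℝ)..T, ‖f t‖ ^ 2) atTop (𝓝 (‖f‖ ^ 2)) := by
  have h0 : ‖f‖ ^ 2 = (meanInner f f).re := InnerProductSpace.norm_sq_eq_re_inner (𝕜 := ℂ) f
  rw [h0]
  refine ((Complex.continuous_re.tendsto _).comp (tendsto_meanInner f f)).congr fun T => ?_
  have h : ∀ t : ℝ, starRingEnd ℂ (f t) * f t = ((‖f t‖ ^ 2 : ℝ) : ℂ) := fun t => by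
    rw [Complex.conj_mul']; push_cast; rfl
  simp only [Function.comp_apply, avg, h]
  rw [intervalIntegral.integral_ofReal, ← Complex.ofReal_mul, Complex.ofReal_re]

/-- The Hilbert space of almost periodic functions: the completion of `AP` for the mean square
norm (functions at distance zero being identified). -/
abbrev APSpace : Type := UniformSpace.Completion AP

/-- The exponential `t ↦ e^{i lam t}` as an element of `AP`. -/
def AP.exp (lam : ℝ) : AP :=
  ⟨expFun lam, Submodule.le_topologicalClosure _ (Submodule.subset_span ⟨lam, rfl⟩)⟩

/-- The exponential `t ↦ e^{i lam t}` as an element of the Hilbert space. -/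
def apExp (lam : ℝ) : APSpace := (AP.exp lam : APSpace)

/-- The orthogonal projection of the Hilbert space onto the line spanned by `v`. -/
def lineProj (v : APSpace) : APSpace →L[ℂ] APSpace := (ℂ ∙ v).starProjection

end

open Filter Topology

noncomputable section

/-! ## Recursive families of natural numbers -/

section Nat

variable {α : Type*} [Primcodable α] {f g : α → ℕ}

/-! Only the norm axiom needs an argument; the other axioms are built into the closure. The point is
that a generated sequence uses finitely many of the projections: one finite `F ⊆ s` serves all its
terms at once. Linear combinations merge two such sets, and limits stay in the span of the same
projections, since this span is finite-dimensional and hence closed.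

On such a span the operators are diagonal, `T = ∑ v ∈ F, ⟨v, T v⟩ P_v`, with norm the largest `|⟨v,
T v⟩|`. The entries of a generated sequence are computable: linear combinations act entrywise, and
`T ↦ ⟨v, T v⟩` is a contraction, so effective limits pass to entries
(`GeneratedSeq.isRecursiveDiagonal`). The maximum of finitely many computable sequences of reals is
computable, which gives the norms (`IsRecursiveDiagonal.norm`). No effective indexing of `s` enters:
`F` and the algorithms only have to exist for each sequence. Hence `s` may be uncountable, as for
the exponentials, and distinct exponentials have distinct projections.

The computable analysis is done for families over any `Primcodable` type, so that sums and limits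
over an extra index are families over `α × ℕ`; `flatten` appears only in passing to and from the
given definitions. -/

theorem Computable.add_nat (hf : Computable f) (hg : Computable g) :
    Computable fun i => f i + g i :=
  Primrec.nat_add.to_comp.comp hf hg

theorem Computable.sub_nat (hf : Computable f) (hg : Computable g) :
    Computable fun i => f i - g i :=
  Primrec.nat_sub.to_comp.comp hf hg

theorem Computable.mul_nat (hf : Computable f) (hg : Computable g) :
    Computable fun i => f i * g i :=
  Primrec.nat_mul.to_comp.comp hf hg

theorem Computable.mod_nat (hf : Computable f) (hg : Computable g) :
    Computable fun i => f i % g i :=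
  Primrec.nat_mod.to_comp.comp hf hg

theorem Computable.sqrt_nat (hf : Computable f) : Computable fun i => (f i).sqrt :=
  Primrec.nat_sqrt.to_comp.comp hf

theorem Computable.two_pow (hf : Computable f) : Computable fun i => 2 ^ f i := by
  have h : Computable fun i => Nat.rec (motive := fun _ => ℕ) 1 (fun _ m => 2 * m) (f i) :=
    Computable.nat_rec (h := fun _ p => 2 * p.2) hf (Computable.const 1)
      ((Computable.const 2).mul_nat (Computable.snd.comp Computable.snd)).to₂
  refine h.of_eq fun i => ?_
  induction f i with
  | zero => rfl
  | succ n ih => rw [pow_succ', ← ih]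

end Nat

/-! ## Recursive families of rational numbers -/

/-- A family of rationals is recursive if it is of the form `(a - b) / (c + 1)` for recursive
families `a`, `b`, `c` of natural numbers. -/
def IsRecursiveRat {α : Type*} [Primcodable α] (q : α → ℚ) : Prop :=
  ∃ a b c : α → ℕ, Computable a ∧ Computable b ∧ Computable c ∧
    ∀ i, q i = ((a i : ℚ) - b i) / (c i + 1)

namespace IsRecursiveRat

variable {α β : Type*} [Primcodable α] [Primcodable β] {q r : α → ℚ}

theorem comp (hq : IsRecursiveRat q) {f : β → α} (hf : Computable f) :
    IsRecursiveRat fun i => q (f i) := by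
  obtain ⟨a, b, c, ha, hb, hc, h⟩ := hq
  exact ⟨_, _, _, ha.comp hf, hb.comp hf, hc.comp hf, fun i => h (f i)⟩

theorem of_nat_div {a c : α → ℕ} (ha : Computable a) (hc : Computable c) :
    IsRecursiveRat fun i => (a i : ℚ) / (c i + 1) :=
  ⟨a, fun _ => 0, c, ha, Computable.const 0, hc, fun i => by simp⟩

/-- The shape `(a - b) / (c + 1)` avoids sign cases and zero denominators; a product of two
denominators is again a successor, that of `c c' + c + c'`. -/
theorem add (hq : IsRecursiveRat q) (hr : IsRecursiveRat r) :
    IsRecursiveRat fun i => q i + r i := by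
  obtain ⟨a, b, c, ha, hb, hc, h⟩ := hq
  obtain ⟨a', b', c', ha', hb', hc', h'⟩ := hr
  have one := Computable.const (α := α) 1
  refine ⟨fun i => a i * (c' i + 1) + a' i * (c i + 1),
    fun i => b i * (c' i + 1) + b' i * (c i + 1),
    fun i => c i * c' i + c i + c' i,
    (ha.mul_nat (hc'.add_nat one)).add_nat (ha'.mul_nat (hc.add_nat one)),
    (hb.mul_nat (hc'.add_nat one)).add_nat (hb'.mul_nat (hc.add_nat one)),
    ((hc.mul_nat hc').add_nat hc).add_nat hc', fun i => ?_⟩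
  have h1 : (c i : ℚ) + 1 ≠ 0 := by positivity
  have h2 : (c' i : ℚ) + 1 ≠ 0 := by positivity
  have h3 : ((c i * c' i + c i + c' i : ℕ) : ℚ) + 1 = (c i + 1) * (c' i + 1) := by push_cast; ring
  dsimp only
  rw [h, h', h3, div_add_div _ _ h1 h2]
  push_cast
  ring

theorem neg (hq : IsRecursiveRat q) : IsRecursiveRat fun i => -q i := by
  obtain ⟨a, b, c, ha, hb, hc, h⟩ := hq
  exact ⟨b, a, c, hb, ha, hc, fun i => by dsimp only; rw [h, ← neg_div, neg_sub]⟩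

theorem mul (hq : IsRecursiveRat q) (hr : IsRecursiveRat r) :
    IsRecursiveRat fun i => q i * r i := by
  obtain ⟨a, b, c, ha, hb, hc, h⟩ := hq
  obtain ⟨a', b', c', ha', hb', hc', h'⟩ := hr
  refine ⟨fun i => a i * a' i + b i * b' i, fun i => a i * b' i + b i * a' i,
    fun i => c i * c' i + c i + c' i, (ha.mul_nat ha').add_nat (hb.mul_nat hb'),
    (ha.mul_nat hb').add_nat (hb.mul_nat ha'), ((hc.mul_nat hc').add_nat hc).add_nat hc',
    fun i => ?_⟩
  have h3 : ((c i * c' i + c i + c' i : ℕ) : ℚ) + 1 = (c i + 1) * (c' i + 1) := by push_cast; ring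
  dsimp only
  rw [h, h', h3, div_mul_div_comm]
  push_cast
  ring

theorem abs (hq : IsRecursiveRat q) : IsRecursiveRat fun i => |q i| := by
  obtain ⟨a, b, c, ha, hb, hc, h⟩ := hq
  -- One of the two truncated differences vanishes, so their sum is `|a - b|`.
  convert of_nat_div ((ha.sub_nat hb).add_nat (hb.sub_nat ha)) hc using 2 with i
  rw [h, abs_div, abs_of_nonneg (by positivity : (0 : ℚ) ≤ c i + 1)]
  congr 1
  rcases le_total (a i) (b i) with hab | hab
  · have : (a i : ℚ) ≤ b i := by exact_mod_cast hab
    simp [Nat.sub_eq_zero_of_le hab, Nat.cast_sub hab, abs_of_nonpos (sub_nonpos.2 this)]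
  · have : (b i : ℚ) ≤ a i := by exact_mod_cast hab
    simp [Nat.sub_eq_zero_of_le hab, Nat.cast_sub hab, abs_of_nonneg (sub_nonneg.2 this)]

theorem sum {q : α × ℕ → ℚ} (hq : IsRecursiveRat q) {d : α → ℕ} (hd : Computable d) :
    IsRecursiveRat fun i => ∑ j ∈ Finset.range (d i), q (i, j) := by
  obtain ⟨a, b, c, ha, hb, hc, h⟩ := hq
  -- The state `(A, B, C)` encodes the partial sum `(A - B) / (C + 1)`, starting from `(0, 0, 0)`;
  -- one step adds the next term by the formula for `add`.
  let step : α → ℕ × (ℕ × ℕ × ℕ) → ℕ × ℕ × ℕ := fun i p =>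
    (a (i, p.1) * (p.2.2.2 + 1) + p.2.1 * (c (i, p.1) + 1),
      b (i, p.1) * (p.2.2.2 + 1) + p.2.2.1 * (c (i, p.1) + 1),
      c (i, p.1) * p.2.2.2 + c (i, p.1) + p.2.2.2)
  have hstep : Computable₂ step := by
    have hi : Computable fun x : α × (ℕ × (ℕ × ℕ × ℕ)) => (x.1, x.2.1) :=
      Computable.fst.pair (Computable.fst.comp Computable.snd)
    have hA : Computable fun x : α × (ℕ × (ℕ × ℕ × ℕ)) => x.2.2.1 :=
      Computable.fst.comp (Computable.snd.comp Computable.snd)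
    have hB : Computable fun x : α × (ℕ × (ℕ × ℕ × ℕ)) => x.2.2.2.1 :=
      Computable.fst.comp (Computable.snd.comp (Computable.snd.comp Computable.snd))
    have hC : Computable fun x : α × (ℕ × (ℕ × ℕ × ℕ)) => x.2.2.2.2 :=
      Computable.snd.comp (Computable.snd.comp (Computable.snd.comp Computable.snd))
    have one := Computable.const (α := α × (ℕ × (ℕ × ℕ × ℕ))) 1
    have a' := ha.comp hi
    have b' := hb.comp hi
    have c' := hc.comp hi
    exact ((a'.mul_nat (hC.add_nat one)).add_nat (hA.mul_nat (c'.add_nat one))).pair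
      (((b'.mul_nat (hC.add_nat one)).add_nat (hB.mul_nat (c'.add_nat one))).pair
        (((c'.mul_nat hC).add_nat c').add_nat hC))
  let R : α → ℕ → ℕ × ℕ × ℕ := fun i n =>
    Nat.rec (motive := fun _ => ℕ × ℕ × ℕ) (0, 0, 0) (fun y IH => step i (y, IH)) n
  have hR : Computable fun i => R i (d i) :=
    Computable.nat_rec hd (Computable.const (0, 0, 0)) hstep
  refine ⟨_, _, _, Computable.fst.comp hR, (Computable.fst.comp Computable.snd).comp hR,
    (Computable.snd.comp Computable.snd).comp hR, fun i => ?_⟩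
  dsimp only
  generalize d i = n
  induction n with
  | zero => simp [R]
  | succ n ih =>
    have h1 : (c (i, n) : ℚ) + 1 ≠ 0 := by positivity
    have h2 : ((R i n).2.2 : ℚ) + 1 ≠ 0 := by positivity
    have hs : R i (n + 1) = step i (n, R i n) := rfl
    have h3 : ((c (i, n) * (R i n).2.2 + c (i, n) + (R i n).2.2 : ℕ) : ℚ) + 1
        = (c (i, n) + 1) * ((R i n).2.2 + 1) := by push_cast; ring
    rw [Finset.sum_range_succ, ih, h, hs]
    simp only [step]
    rw [h3, div_add_div _ _ h2 h1]
    push_cast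
    rw [mul_comm ((R i n).2.2 + 1 : ℚ)]
    ring

end IsRecursiveRat

theorem ComputableRatSeq.isRecursiveRat {q : ℕ → ℚ} (hq : ComputableRatSeq q) :
    IsRecursiveRat q := by
  obtain ⟨s, a, b, hs, ha, hb, h⟩ := hq
  have one := Computable.const (α := ℕ) 1
  have hp := hs.mod_nat (Computable.const 2)
  -- The parity of `s i` sends the numerator to the positive or to the negative part.
  refine ⟨fun i => a i * (1 - s i % 2), fun i => a i * (s i % 2), fun i => b i - 1,
    ha.mul_nat (one.sub_nat hp), ha.mul_nat hp, hb.sub_nat one, fun i => ?_⟩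
  obtain ⟨h0, h1⟩ := h i
  have : ((b i - 1 : ℕ) : ℚ) + 1 = b i := by
    rw [Nat.cast_sub (Nat.one_le_iff_ne_zero.2 h0)]; simp
  rw [h1, this]
  rcases Nat.even_or_odd (s i) with he | ho
  · simp [he.neg_one_pow, Nat.even_iff.1 he]
  · simp [ho.neg_one_pow, Nat.odd_iff.1 ho]

theorem IsRecursiveRat.computableRatSeq {q : ℕ → ℚ} (hq : IsRecursiveRat q) :
    ComputableRatSeq q := by
  obtain ⟨a, b, c, ha, hb, hc, h⟩ := hq
  have one := Computable.const (α := ℕ) 1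
  -- With truncated subtraction the sign exponent is `0` if `b i ≤ a i` and `1` otherwise.
  refine ⟨fun i => 1 - (a i + 1 - b i), fun i => (a i - b i) + (b i - a i), fun i => c i + 1,
    one.sub_nat ((ha.add_nat one).sub_nat hb), (ha.sub_nat hb).add_nat (hb.sub_nat ha),
    hc.add_nat one, fun i => ⟨by positivity, ?_⟩⟩
  rw [h]
  push_cast
  congr 1
  rcases le_or_gt (b i) (a i) with hab | hab
  · rw [show 1 - (a i + 1 - b i) = 0 by omega, Nat.sub_eq_zero_of_le hab, Nat.cast_sub hab]
    simp
  · rw [show 1 - (a i + 1 - b i) = 1 by omega, Nat.sub_eq_zero_of_le hab.le, Nat.cast_sub hab.le]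
    simp

/-! ## Recursive families of real numbers -/

/-- A family of reals is recursive if a recursive family of rationals approximates it to within
any given power of `1 / 2`. -/
def IsRecursiveReal {α : Type*} [Primcodable α] (x : α → ℝ) : Prop :=
  ∃ q : α × ℕ → ℚ, IsRecursiveRat q ∧ ∀ i k, |x i - q (i, k)| ≤ (1 / 2 : ℝ) ^ k

theorem half_pow_succ_add_self (k : ℕ) :
    (1 / 2 : ℝ) ^ (k + 1) + (1 / 2 : ℝ) ^ (k + 1) = (1 / 2) ^ k := by
  rw [pow_succ]; ring

theorem half_pow_le_half_pow {k m : ℕ} (h : k ≤ m) : (1 / 2 : ℝ) ^ m ≤ (1 / 2) ^ k :=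
  pow_le_pow_of_le_one (by norm_num) (by norm_num) h

/-- Since `n ≤ 2 ^ n`, an error amplified `n` times is absorbed by `n` extra binary digits. -/
theorem natCast_mul_half_pow_add_le (n k : ℕ) : (n : ℝ) * (1 / 2) ^ (k + n) ≤ (1 / 2) ^ k := by
  have h1 : (n : ℝ) ≤ 2 ^ n := by exact_mod_cast n.lt_two_pow_self.le
  have h2 : (2 : ℝ) ^ n * (1 / 2) ^ n = 1 := by rw [← mul_pow]; norm_num
  rw [pow_add]
  calc (n : ℝ) * ((1 / 2) ^ k * (1 / 2) ^ n) ≤ 2 ^ n * ((1 / 2) ^ k * (1 / 2) ^ n) := by gcongr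
    _ = (1 / 2) ^ k * (2 ^ n * (1 / 2) ^ n) := by ring
    _ = _ := by rw [h2, mul_one]

namespace IsRecursiveReal

variable {α β : Type*} [Primcodable α] [Primcodable β] {x y : α → ℝ}

theorem comp (hx : IsRecursiveReal x) {f : β → α} (hf : Computable f) :
    IsRecursiveReal fun i => x (f i) := by
  obtain ⟨q, hq, h⟩ := hx
  exact ⟨fun i => q (f i.1, i.2), hq.comp ((hf.comp Computable.fst).pair Computable.snd),
    fun i k => h (f i) k⟩

theorem of_rat {q : α → ℚ} (hq : IsRecursiveRat q) : IsRecursiveReal fun i => (q i : ℝ) :=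
  ⟨fun i => q i.1, hq.comp Computable.fst, fun i k => by simp⟩

theorem natCast (n : ℕ) : IsRecursiveReal fun _ : α => (n : ℝ) := by
  simpa using of_rat (IsRecursiveRat.of_nat_div (α := α) (Computable.const n) (Computable.const 0))

theorem limit {x : α × ℕ → ℝ} (hx : IsRecursiveReal x) {e : α → ℕ → ℕ} (he : Computable₂ e)
    (h : ∀ i N k, e i N ≤ k → |x (i, k) - y i| ≤ (1 / 2) ^ N) : IsRecursiveReal y := by
  obtain ⟨q, hq, hxq⟩ := hx
  have hs : Computable fun p : α × ℕ => p.2 + 1 := Computable.snd.add_nat (Computable.const 1)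
  refine ⟨fun p => q ((p.1, e p.1 (p.2 + 1)), p.2 + 1),
    hq.comp ((Computable.fst.pair (he.comp Computable.fst hs)).pair hs), fun i k => ?_⟩
  have h1 := h i (k + 1) _ le_rfl
  have h2 := hxq (i, e i (k + 1)) (k + 1)
  rw [abs_sub_comm] at h1
  rw [← half_pow_succ_add_self]
  exact (abs_sub_le _ _ _).trans (add_le_add h1 h2)

theorem add (hx : IsRecursiveReal x) (hy : IsRecursiveReal y) :
    IsRecursiveReal fun i => x i + y i := by
  obtain ⟨q, hq, hxq⟩ := hx
  obtain ⟨r, hr, hyr⟩ := hy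
  have hs : Computable fun p : α × ℕ => (p.1, p.2 + 1) :=
    Computable.fst.pair (Computable.snd.add_nat (Computable.const 1))
  refine ⟨_, (hq.comp hs).add (hr.comp hs), fun i k => ?_⟩
  rw [← half_pow_succ_add_self]
  push_cast
  rw [add_sub_add_comm]
  exact (abs_add_le _ _).trans (add_le_add (hxq _ _) (hyr _ _))

theorem neg (hx : IsRecursiveReal x) : IsRecursiveReal fun i => -x i := by
  obtain ⟨q, hq, hxq⟩ := hx
  refine ⟨_, hq.neg, fun i k => ?_⟩
  push_cast
  rw [← neg_sub', abs_neg]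
  exact hxq i k

theorem sub (hx : IsRecursiveReal x) (hy : IsRecursiveReal y) :
    IsRecursiveReal fun i => x i - y i := by
  simpa only [sub_eq_add_neg] using hx.add hy.neg

theorem abs (hx : IsRecursiveReal x) : IsRecursiveReal fun i => |x i| := by
  obtain ⟨q, hq, hxq⟩ := hx
  refine ⟨_, hq.abs, fun i k => ?_⟩
  push_cast
  exact (abs_abs_sub_abs_le_abs_sub _ _).trans (hxq i k)

/-- A recursive family of reals has a recursive family of natural bounds. -/
theorem exists_nat_bound (hx : IsRecursiveReal x) :
    ∃ B : α → ℕ, Computable B ∧ ∀ i, |x i| ≤ B i := by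
  obtain ⟨q, ⟨a, b, c, ha, hb, -, h⟩, hxq⟩ := hx
  have h0 : Computable fun i : α => (i, 0) := Computable.id.pair (Computable.const 0)
  -- The denominator is at least `1`, so `a + b` bounds the approximation of index `0`; the last `1`
  -- is its error.
  refine ⟨fun i => a (i, 0) + b (i, 0) + 1,
    ((ha.comp h0).add_nat (hb.comp h0)).add_nat (Computable.const 1), fun i => ?_⟩
  have h1 : |(q (i, 0) : ℝ)| ≤ a (i, 0) + b (i, 0) := by
    rw [h]
    push_cast
    rw [abs_div, abs_of_nonneg (by positivity : (0 : ℝ) ≤ c (i, 0) + 1)]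
    refine (div_le_self (abs_nonneg _) (by simp)).trans ((abs_sub _ _).trans ?_)
    simp
  have h2 := hxq i 0
  have h3 := abs_sub_abs_le_abs_sub (x i) (q (i, 0))
  push_cast
  rw [pow_zero] at h2
  linarith

theorem mul (hx : IsRecursiveReal x) (hy : IsRecursiveReal y) :
    IsRecursiveReal fun i => x i * y i := by
  obtain ⟨B, hB, hxB⟩ := hx.exists_nat_bound
  obtain ⟨C, hC, hyC⟩ := hy.exists_nat_bound
  obtain ⟨q, hq, hxq⟩ := hx
  obtain ⟨r, hr, hyr⟩ := hy
  -- At precision `m` the product errs by at most `(B + C + 1) / 2 ^ m`: the factor `x` is bounded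
  -- by `B`, the approximation of `y` by `C + 1`.
  have hs : Computable fun p : α × ℕ => (p.1, p.2 + 1 + (B p.1 + C p.1 + 1)) :=
    Computable.fst.pair ((Computable.snd.add_nat (Computable.const 1)).add_nat
      (((hB.comp Computable.fst).add_nat (hC.comp Computable.fst)).add_nat (Computable.const 1)))
  refine ⟨_, (hq.comp hs).mul (hr.comp hs), fun i k => ?_⟩
  set m := k + 1 + (B i + C i + 1) with hm
  have h1 := hxq i m
  have h2 := hyr i m
  have hA := natCast_mul_half_pow_add_le (B i + C i + 1) (k + 1)
  rw [← hm] at hA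
  set Q : ℝ := (q (i, m) : ℝ)
  set R : ℝ := (r (i, m) : ℝ)
  have hR : |R| ≤ (C i : ℝ) + 1 := by
    have h3 := abs_sub_abs_le_abs_sub R (y i)
    rw [abs_sub_comm] at h3
    have h4 : (1 / 2 : ℝ) ^ m ≤ 1 := pow_le_one₀ (by norm_num) (by norm_num)
    linarith [hyC i]
  have key : x i * y i - ((q (i, m) * r (i, m) : ℚ) : ℝ) = x i * (y i - R) + (x i - Q) * R := by
    push_cast; ring
  have e1 : |x i| * |y i - R| ≤ B i * (1 / 2) ^ m :=
    mul_le_mul (hxB i) h2 (abs_nonneg _) (by positivity)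
  have e2 : |x i - Q| * |R| ≤ (1 / 2) ^ m * (C i + 1) :=
    mul_le_mul h1 hR (abs_nonneg _) (by positivity)
  have hk : (1 / 2 : ℝ) ^ (k + 1) ≤ (1 / 2) ^ k := half_pow_le_half_pow (Nat.le_succ k)
  push_cast at hA
  calc _ = |x i * (y i - R) + (x i - Q) * R| := by rw [← key]
    _ ≤ |x i| * |y i - R| + |x i - Q| * |R| := by
      rw [← abs_mul, ← abs_mul]; exact abs_add_le _ _
    _ ≤ (1 / 2) ^ k := by linarith

/-- The order of two recursive reals is not decidable, so the formula `(x + y + |x - y|) / 2`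
replaces a case distinction. -/
theorem max (hx : IsRecursiveReal x) (hy : IsRecursiveReal y) :
    IsRecursiveReal fun i => max (x i) (y i) := by
  have half : IsRecursiveReal fun _ : α => ((1 / 2 : ℚ) : ℝ) := by
    refine of_rat ?_
    convert IsRecursiveRat.of_nat_div (α := α) (Computable.const 1) (Computable.const 1) using 2
    norm_num
  convert ((hx.add hy).add (hx.sub hy).abs).mul half using 2 with i
  push_cast
  rcases le_total (x i) (y i) with h | h
  · rw [max_eq_right h, abs_of_nonpos (sub_nonpos.2 h)]; ring
  · rw [max_eq_left h, abs_of_nonneg (sub_nonneg.2 h)]; ring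

theorem sum {x : α × ℕ → ℝ} (hx : IsRecursiveReal x) {d : α → ℕ} (hd : Computable d) :
    IsRecursiveReal fun i => ∑ j ∈ Finset.range (d i), x (i, j) := by
  obtain ⟨q, hq, hxq⟩ := hx
  have hs : Computable fun p : (α × ℕ) × ℕ => ((p.1.1, p.2), p.1.2 + d p.1.1) :=
    ((Computable.fst.comp Computable.fst).pair Computable.snd).pair
      ((Computable.snd.comp Computable.fst).add_nat
        (hd.comp (Computable.fst.comp Computable.fst)))
  refine ⟨_, (hq.comp hs).sum (hd.comp Computable.fst), fun i k => ?_⟩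
  push_cast
  rw [← Finset.sum_sub_distrib]
  refine (Finset.abs_sum_le_sum_abs _ _).trans ?_
  refine (Finset.sum_le_sum fun j _ => hxq (i, j) (k + d i)).trans ?_
  rw [Finset.sum_const, Finset.card_range, nsmul_eq_mul]
  exact natCast_mul_half_pow_add_le _ _

end IsRecursiveReal

theorem Real.abs_sqrt_sub_sqrt_le (x y : ℝ) : |√x - √y| ≤ √|x - y| := by
  wlog h : y ≤ x generalizing x y
  · rw [abs_sub_comm, abs_sub_comm x]
    exact this y x (le_of_not_ge h)
  rw [abs_of_nonneg (sub_nonneg.2 (Real.sqrt_le_sqrt h)), abs_of_nonneg (sub_nonneg.2 h),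
    sub_le_iff_le_add]
  rcases le_total 0 y with hy | hy
  · refine Real.sqrt_le_iff.2 ⟨by positivity, ?_⟩
    have h1 := Real.sq_sqrt (sub_nonneg.2 h)
    have h2 := Real.sq_sqrt hy
    nlinarith [mul_nonneg (Real.sqrt_nonneg (x - y)) (Real.sqrt_nonneg y)]
  · rw [Real.sqrt_eq_zero_of_nonpos hy, add_zero]
    exact Real.sqrt_le_sqrt (by linarith)

/-- With `D = (c + 1) 2 ^ k` the root is `√n / D` for the natural number `n = (a - b) (c + 1) 4 ^
k`. The integer root of `n` errs by at most `1`, hence the quotient by at most `1 / D`. For negative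
`q`, truncation gives `n = 0`, matching the value `0` of the real square root. -/
theorem IsRecursiveRat.sqrt {α : Type*} [Primcodable α] {q : α → ℚ} (hq : IsRecursiveRat q) :
    IsRecursiveReal fun i => √(q i : ℝ) := by
  obtain ⟨a, b, c, ha, hb, hc, h⟩ := hq
  have one := Computable.const (α := α × ℕ) 1
  have ha' := ha.comp (Computable.fst (α := α) (β := ℕ))
  have hb' := hb.comp (Computable.fst (α := α) (β := ℕ))
  have hc' := hc.comp (Computable.fst (α := α) (β := ℕ))
  have hk := (Computable.snd (α := α) (β := ℕ)).two_pow
  have hden := (hc'.add_nat one).mul_nat hk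
  refine ⟨_, IsRecursiveRat.of_nat_div
    (((ha'.sub_nat hb').mul_nat (hc'.add_nat one)).mul_nat (hk.mul_nat hk)).sqrt_nat
    (hden.sub_nat one), fun i k => ?_⟩
  dsimp only
  set D : ℕ := (c i + 1) * 2 ^ k with hD
  have hD0 : 1 ≤ D := Nat.one_le_iff_ne_zero.2 (by positivity)
  set n : ℕ := (a i - b i) * (c i + 1) * (2 ^ k * 2 ^ k) with hn
  have hDr : (0 : ℝ) < D := by exact_mod_cast hD0
  have hsq : √(q i : ℝ) = √(n : ℝ) / D := by
    have hc0 : (0 : ℝ) < c i + 1 := by positivity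
    have e : (n : ℝ) / (D : ℝ) ^ 2 = ((a i - b i : ℕ) : ℝ) / (c i + 1) := by
      rw [hn, hD]; push_cast; field_simp
    rw [← Real.sqrt_sq hDr.le, ← Real.sqrt_div' _ (by positivity), e, h]
    push_cast
    rcases le_total (b i) (a i) with hab | hab
    · rw [Nat.cast_sub hab]
    · have : (a i : ℝ) ≤ b i := by exact_mod_cast hab
      rw [Nat.sub_eq_zero_of_le hab, Real.sqrt_eq_zero_of_nonpos]
      · simp
      · exact div_nonpos_of_nonpos_of_nonneg (by linarith) hc0.le
  have h1 : (n.sqrt : ℝ) ≤ √(n : ℝ) := Real.nat_sqrt_le_real_sqrt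
  have h2 : √(n : ℝ) ≤ n.sqrt + 1 := Real.real_sqrt_le_nat_sqrt_succ
  have hcast : ((D - 1 : ℕ) : ℝ) + 1 = D := by rw [Nat.cast_sub hD0]; simp
  push_cast
  rw [hcast, hsq, ← sub_div, abs_div, abs_of_nonneg (by linarith), abs_of_pos hDr,
    div_le_iff₀ hDr, hD]
  push_cast
  have h3 : (1 / 2 : ℝ) ^ k * ((c i + 1) * 2 ^ k) = c i + 1 := by
    rw [mul_comm ((c i : ℝ) + 1), ← mul_assoc, ← mul_pow]; norm_num
  rw [h3]
  have : (0 : ℝ) ≤ c i := by positivity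
  linarith

theorem IsRecursiveReal.sqrt {α : Type*} [Primcodable α] {x : α → ℝ} (hx : IsRecursiveReal x) :
    IsRecursiveReal fun i => √(x i) := by
  obtain ⟨q, hq, hxq⟩ := hx
  -- The square root is Hölder of exponent `1 / 2`, so it halves the number of correct digits.
  have he : Computable₂ fun (_ : α) N => N + N := Computable.snd.add_nat Computable.snd
  refine hq.sqrt.limit he fun i N k hk => ?_
  refine (Real.abs_sqrt_sub_sqrt_le _ _).trans (Real.sqrt_le_iff.2 ⟨by positivity, ?_⟩)
  rw [abs_sub_comm, sq, ← pow_add]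
  exact (hxq i k).trans (half_pow_le_half_pow hk)

theorem isRecursiveReal_iff {x : ℕ → ℝ} : IsRecursiveReal x ↔ ComputableRealSeq x := by
  constructor
  · rintro ⟨q, hq, h⟩
    refine ⟨fun n k => q (n, k),
      (hq.comp (f := Nat.unpair) Computable.unpair).computableRatSeq,
      fun _ N => N, Computable.snd, fun n N k hk => ?_⟩
    rw [dist_comm]
    exact (h n k).trans (half_pow_le_half_pow hk)
  · rintro ⟨q, hq, e, he, h⟩
    have hq' : IsRecursiveRat fun p : ℕ × ℕ => q p.1 p.2 := by
      simpa [flatten] using hq.isRecursiveRat.comp (f := fun p : ℕ × ℕ => Nat.pair p.1 p.2)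
        Primrec₂.natPair.to_comp
    exact (IsRecursiveReal.of_rat hq').limit he fun n N k hk => h n N k hk

/-! ## Recursive families of complex numbers -/

/-- A family of complex numbers is recursive if its real and imaginary parts are. -/
def IsRecursiveComplex {α : Type*} [Primcodable α] (z : α → ℂ) : Prop :=
  IsRecursiveReal (fun i => (z i).re) ∧ IsRecursiveReal (fun i => (z i).im)

theorem isRecursiveComplex_iff {z : ℕ → ℂ} : IsRecursiveComplex z ↔ ComputableComplexSeq z :=
  and_congr isRecursiveReal_iff isRecursiveReal_iff

namespace IsRecursiveComplex

variable {α β : Type*} [Primcodable α] [Primcodable β] {z w : α → ℂ}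

theorem natCast (n : ℕ) : IsRecursiveComplex fun _ : α => (n : ℂ) := by
  constructor
  · simpa using IsRecursiveReal.natCast n
  · simpa using IsRecursiveReal.natCast 0

theorem comp (hz : IsRecursiveComplex z) {f : β → α} (hf : Computable f) :
    IsRecursiveComplex fun i => z (f i) :=
  ⟨hz.1.comp hf, hz.2.comp hf⟩

theorem add (hz : IsRecursiveComplex z) (hw : IsRecursiveComplex w) :
    IsRecursiveComplex fun i => z i + w i :=
  ⟨by simpa using hz.1.add hw.1, by simpa using hz.2.add hw.2⟩

theorem mul (hz : IsRecursiveComplex z) (hw : IsRecursiveComplex w) :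
    IsRecursiveComplex fun i => z i * w i :=
  ⟨by simpa using (hz.1.mul hw.1).sub (hz.2.mul hw.2),
    by simpa using (hz.1.mul hw.2).add (hz.2.mul hw.1)⟩

theorem sum {z : α × ℕ → ℂ} (hz : IsRecursiveComplex z) {d : α → ℕ} (hd : Computable d) :
    IsRecursiveComplex fun i => ∑ j ∈ Finset.range (d i), z (i, j) :=
  ⟨by simpa using hz.1.sum hd, by simpa using hz.2.sum hd⟩

theorem limit {z : α × ℕ → ℂ} (hz : IsRecursiveComplex z) {e : α → ℕ → ℕ} (he : Computable₂ e)
    (h : ∀ i N k, e i N ≤ k → ‖z (i, k) - w i‖ ≤ (1 / 2) ^ N) : IsRecursiveComplex w :=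
  ⟨hz.1.limit he fun i N k hk => by
      simpa using (Complex.abs_re_le_norm (z (i, k) - w i)).trans (h i N k hk),
    hz.2.limit he fun i N k hk => by
      simpa using (Complex.abs_im_le_norm (z (i, k) - w i)).trans (h i N k hk)⟩

theorem norm (hz : IsRecursiveComplex z) : IsRecursiveReal fun i => ‖z i‖ := by
  simpa [Complex.norm_def, Complex.normSq_apply] using
    ((hz.1.mul hz.1).add (hz.2.mul hz.2)).sqrt

/-- Reading a double sequence as a single one does not affect recursiveness. -/
theorem of_flatten {z : ℕ → ℕ → ℂ} (hz : IsRecursiveComplex (flatten z)) :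
    IsRecursiveComplex fun p : ℕ × ℕ => z p.1 p.2 := by
  simpa [flatten] using hz.comp (f := fun p : ℕ × ℕ => Nat.pair p.1 p.2)
    Primrec₂.natPair.to_comp

end IsRecursiveComplex

/-! ## Sequences generated by rank-one projections -/

section Hilbert

variable {H : Type*} [NormedAddCommGroup H] [InnerProductSpace ℂ H]

/-- The orthogonal projection onto the line spanned by `v`. -/
abbrev projLine (v : H) : H →L[ℂ] H := (ℂ ∙ v).starProjection

theorem projLine_apply {v : H} (hv : ‖v‖ = 1) (w : H) : projLine v w = inner ℂ v w • v :=
  Submodule.starProjection_unit_singleton ℂ hv w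

variable {s : Set H}

/-! ### Diagonal entries and the norm of a diagonal operator -/

theorem inner_eq_zero_of_mem (hs : Orthonormal ℂ (Subtype.val : s → H))
    {v w : H} (hv : v ∈ s) (hw : w ∈ s) (h : v ≠ w) :
    inner ℂ v w = 0 :=
  hs.2 (i := ⟨v, hv⟩) (j := ⟨w, hw⟩) (by simpa using h)

theorem norm_eq_one_of_mem (hs : Orthonormal ℂ (Subtype.val : s → H))
    {v : H} (hv : v ∈ s) : ‖v‖ = 1 := hs.1 ⟨v, hv⟩

theorem inner_projLine_self (hs : Orthonormal ℂ (Subtype.val : s → H))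
    {v : H} (hv : v ∈ s) : inner ℂ v (projLine v v) = 1 := by
  have h := norm_eq_one_of_mem hs hv
  rw [projLine_apply h, inner_smul_right, inner_self_eq_norm_sq_to_K, h]
  simp

theorem inner_projLine_of_ne (hs : Orthonormal ℂ (Subtype.val : s → H))
    {v g : H} (hv : v ∈ s) (hg : g ∈ s) (h : v ≠ g) :
    inner ℂ v (projLine g v) = 0 := by
  rw [projLine_apply (norm_eq_one_of_mem hs hg), inner_smul_right,
    inner_eq_zero_of_mem hs hv hg h, mul_zero]

theorem projLine_injOn (hs : Orthonormal ℂ (Subtype.val : s → H)) :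
    Set.InjOn (projLine : H → H →L[ℂ] H) s := by
  intro v hv w hw h
  by_contra hne
  have h1 := inner_projLine_self hs hv
  rw [h, inner_projLine_of_ne hs hv hw hne] at h1
  exact zero_ne_one h1

theorem norm_inner_apply_le (hs : Orthonormal ℂ (Subtype.val : s → H))
    {v : H} (hv : v ∈ s) (T : H →L[ℂ] H) : ‖inner ℂ v (T v)‖ ≤ ‖T‖ := by
  have h := norm_eq_one_of_mem hs hv
  refine (norm_inner_le_norm _ _).trans ?_
  simpa [h] using T.le_opNorm v

/-- An operator in the span of finitely many of the projections is diagonal. -/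
theorem eq_sum_inner_smul_projLine (hs : Orthonormal ℂ (Subtype.val : s → H))
    {F : Finset H} (hF : ↑F ⊆ s) {T : H →L[ℂ] H}
    (hT : T ∈ Submodule.span ℂ (projLine '' (F : Set H))) :
    T = ∑ v ∈ F, (inner ℂ v (T v) : ℂ) • projLine v := by
  classical
  induction hT using Submodule.span_induction with
  | mem T h =>
    obtain ⟨g, hg, rfl⟩ := h
    rw [Finset.sum_eq_single g, inner_projLine_self hs (hF hg), one_smul]
    · intro v hv hne
      rw [inner_projLine_of_ne hs (hF hv) (hF hg) hne, zero_smul]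
    · exact fun h => absurd hg h
  | zero => simp
  | add T U _ _ hT hU =>
    simp only [add_apply, inner_add_right, add_smul, Finset.sum_add_distrib]
    rw [← hT, ← hU]
  | smul c T _ hT =>
    simp only [smul_apply, inner_smul_right, mul_smul, ← Finset.smul_sum]
    rw [← hT]

/-- The coordinates of `T w` are `⟨v, T v⟩ ⟨v, w⟩`, so Pythagoras computes `‖T w‖²` and Bessel's
inequality bounds it by `M² ‖w‖²`. -/
theorem norm_le_of_mem_span (hs : Orthonormal ℂ (Subtype.val : s → H))
    {F : Finset H} (hF : ↑F ⊆ s) {T : H →L[ℂ] H}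
    (hT : T ∈ Submodule.span ℂ (projLine '' (F : Set H))) {M : ℝ} (hM : 0 ≤ M)
    (h : ∀ v ∈ F, ‖inner ℂ v (T v)‖ ≤ M) : ‖T‖ ≤ M := by
  refine T.opNorm_le_bound hM fun w => ?_
  have hFs : Orthonormal ℂ (Subtype.val : F → H) :=
    hs.comp (fun v : F => (⟨v, hF v.2⟩ : s)) fun v w h =>
      Subtype.ext (congrArg (fun x : s => (x : H)) h)
  have hTw : T w = ∑ v : F, (inner ℂ (v : H) (T v) * inner ℂ (v : H) w : ℂ) • (v : H) := by
    conv_lhs => rw [eq_sum_inner_smul_projLine hs hF hT]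
    rw [sum_apply, ← Finset.sum_coe_sort F]
    refine Finset.sum_congr rfl fun v _ => ?_
    rw [smul_apply, projLine_apply (norm_eq_one_of_mem hs (hF v.2)), smul_smul]
  have hsq : ‖T w‖ ^ 2 = ∑ v : F, ‖(inner ℂ (v : H) (T v) * inner ℂ (v : H) w : ℂ)‖ ^ 2 := by
    have e := hFs.inner_sum (fun v => inner ℂ (v : H) (T v) * inner ℂ (v : H) w)
      (fun v => inner ℂ (v : H) (T v) * inner ℂ (v : H) w) Finset.univ
    rw [← hTw, inner_self_eq_norm_sq_to_K] at e
    simp only [Complex.conj_mul'] at e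
    have e' : ((‖T w‖ ^ 2 : ℝ) : ℂ) =
        ((∑ v : F, ‖(inner ℂ (v : H) (T v) * inner ℂ (v : H) w : ℂ)‖ ^ 2 : ℝ) : ℂ) := by
      push_cast
      exact e
    exact Complex.ofReal_injective e'
  refine le_of_sq_le_sq ?_ (by positivity)
  rw [hsq, mul_pow]
  calc _ ≤ ∑ v : F, M ^ 2 * ‖inner ℂ (v : H) w‖ ^ 2 := by
        refine Finset.sum_le_sum fun v _ => ?_
        rw [norm_mul, mul_pow]
        gcongr
        exact h v v.2
    _ = M ^ 2 * ∑ v : F, ‖inner ℂ (v : H) w‖ ^ 2 := by rw [Finset.mul_sum]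
    _ ≤ M ^ 2 * ‖w‖ ^ 2 := by
        gcongr
        exact hFs.sum_inner_products_le w

/-- The maximum of `0` and finitely many recursive families of reals is recursive. -/
theorem IsRecursiveReal.exists_max {ι α : Type*} [Primcodable α] (F : Finset ι) {f : ι → α → ℝ}
    (hf : ∀ v ∈ F, IsRecursiveReal (f v)) :
    ∃ M : α → ℝ, IsRecursiveReal M ∧
      ∀ i, 0 ≤ M i ∧ (∀ v ∈ F, f v i ≤ M i) ∧ (M i = 0 ∨ ∃ v ∈ F, M i = f v i) := by
  classical
  induction F using Finset.induction_on with
  | empty => exact ⟨fun _ => 0, by simpa using IsRecursiveReal.natCast (α := α) 0, by simp⟩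
  | insert a F _ ih =>
    obtain ⟨M, hM, h⟩ := ih fun v hv => hf v (Finset.mem_insert_of_mem hv)
    refine ⟨_, (hf a (Finset.mem_insert_self _ _)).max hM, fun i => ?_⟩
    obtain ⟨h0, h1, h2⟩ := h i
    refine ⟨h0.trans (le_max_right _ _), fun v hv => ?_, ?_⟩
    · rcases Finset.mem_insert.1 hv with rfl | hv
      · exact le_max_left _ _
      · exact (h1 v hv).trans (le_max_right _ _)
    · rcases max_choice (f a i) (M i) with hm | hm
      · exact Or.inr ⟨a, Finset.mem_insert_self _ _, hm⟩
      · rw [hm]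
        exact h2.imp_right fun ⟨v, hv, e⟩ => ⟨v, Finset.mem_insert_of_mem hv, e⟩

/-- A sequence of operators in the span of finitely many of the projections onto the lines
`ℂ v`, `v ∈ s`, all of whose diagonal coefficients are computable. -/
structure IsRecursiveDiagonal (s : Set H) (T : ℕ → H →L[ℂ] H) : Prop where
  coeff : ∀ v ∈ s, IsRecursiveComplex fun n => inner ℂ v (T n v)
  mem_span : ∃ F : Finset H, ↑F ⊆ s ∧ ∀ n, T n ∈ Submodule.span ℂ (projLine '' (F : Set H))

theorem IsRecursiveDiagonal.norm (hs : Orthonormal ℂ (Subtype.val : s → H))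
    {T : ℕ → H →L[ℂ] H} (hT : IsRecursiveDiagonal s T) :
    IsRecursiveReal fun n => ‖T n‖ := by
  obtain ⟨F, hF, hspan⟩ := hT.mem_span
  obtain ⟨M, hM, h⟩ := IsRecursiveReal.exists_max F
    (f := fun v n => ‖(inner ℂ v (T n v) : ℂ)‖) fun v hv => (hT.coeff v (hF hv)).norm
  convert hM using 2 with n
  obtain ⟨h0, h1, h2⟩ := h n
  refine le_antisymm (norm_le_of_mem_span hs hF (hspan n) h0 h1) ?_
  -- The maximum is `0` or a modulus of a diagonal entry; neither exceeds `‖T n‖`.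
  rcases h2 with h2 | ⟨v, hv, h2⟩
  · rw [h2]; exact norm_nonneg _
  · rw [h2]; exact norm_inner_apply_le hs (hF hv) _

/-- Every sequence generated by the projections is diagonal with computable coefficients. -/
theorem GeneratedSeq.isRecursiveDiagonal (hs : Orthonormal ℂ (Subtype.val : s → H))
    {T : ℕ → H →L[ℂ] H}
    (hT : GeneratedSeq (projLine '' s) T) : IsRecursiveDiagonal s T := by
  classical
  induction hT with
  | const T hT =>
    obtain ⟨g, hg, rfl⟩ := hT
    refine ⟨fun v hv => ?_, {g}, by simpa using hg, fun n => Submodule.subset_span ⟨g, by simp⟩⟩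
    by_cases h : v = g
    · subst h
      simpa only [inner_projLine_self hs hv, Nat.cast_one] using
        IsRecursiveComplex.natCast (α := ℕ) 1
    · simpa only [inner_projLine_of_ne hs hv hg h, Nat.cast_zero] using
        IsRecursiveComplex.natCast (α := ℕ) 0
  | linear_combination x y _ _ α β hα hβ d hd ihx ihy =>
    refine ⟨fun v hv => ?_, ?_⟩
    · simp only [sum_apply, add_apply,
        smul_apply, inner_sum, inner_add_right, inner_smul_right]
      have hα' := (isRecursiveComplex_iff.2 hα).of_flatten
      have hβ' := (isRecursiveComplex_iff.2 hβ).of_flatten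
      have hx := (ihx.coeff v hv).comp (Computable.snd (α := ℕ) (β := ℕ))
      have hy := (ihy.coeff v hv).comp (Computable.snd (α := ℕ) (β := ℕ))
      exact ((hα'.mul hx).add (hβ'.mul hy)).sum (hd.add_nat (Computable.const 1))
    · obtain ⟨F, hF, hx⟩ := ihx.mem_span
      obtain ⟨K, hK, hy⟩ := ihy.mem_span
      -- The union does not depend on `n`, although the number of summands does.
      refine ⟨F ∪ K, by simp [hF, hK], fun n => Submodule.sum_mem _ fun k _ => ?_⟩
      refine add_mem (Submodule.smul_mem _ _ ?_) (Submodule.smul_mem _ _ ?_)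
      · exact Submodule.span_mono (Set.image_mono (by simp)) (hx k)
      · exact Submodule.span_mono (Set.image_mono (by simp)) (hy k)
  | limit x _ y hy ih =>
    have hx : ∀ n k, x n k = flatten x (Nat.pair n k) := fun n k => by simp [flatten]
    obtain ⟨e, he, hxy⟩ := hy
    refine ⟨fun v hv => ?_, ?_⟩
    -- Taking a diagonal entry is a contraction, so the modulus of convergence of the operators
    -- serves for the entries.
    · refine ((ih.coeff v hv).of_flatten (z := fun n k => inner ℂ v (x n k v))).limit he
        fun n N k hk => ?_
      rw [← inner_sub_right, ← sub_apply]
      refine (norm_inner_apply_le hs hv _).trans ?_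
      rw [← dist_eq_norm]
      exact hxy n N k hk
    · obtain ⟨F, hF, hspan⟩ := ih.mem_span
      refine ⟨F, hF, fun n => ?_⟩
      have : FiniteDimensional ℂ (Submodule.span ℂ (projLine '' (F : Set H))) :=
        FiniteDimensional.span_of_finite ℂ (F.finite_toSet.image _)
      refine (Submodule.closed_of_finiteDimensional _).mem_of_tendsto (f := x n) (b := atTop) ?_
        (Eventually.of_forall fun k => ?_)
      · rw [Metric.tendsto_atTop]
        intro ε hε
        obtain ⟨N, hN⟩ := exists_pow_lt_of_lt_one hε (by norm_num : (1 / 2 : ℝ) < 1)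
        exact ⟨e n N, fun k hk => (hxy n N k hk).trans_lt hN⟩
      · rw [SetLike.mem_coe, hx]
        exact hspan _

/-! ### The generated computability structure and its computable elements -/

theorem isComputabilityStructure_generatedStructure [CompleteSpace H]
    (hs : Orthonormal ℂ (Subtype.val : s → H)) (hne : s.Nonempty) :
    IsComputabilityStructure (generatedStructure (projLine '' s)) where
  nonempty := hne.elim fun v hv => ⟨_, GeneratedSeq.const _ ⟨v, hv, rfl⟩⟩
  linear_combination x hx y hy α β hα hβ d hd :=
    GeneratedSeq.linear_combination x y hx hy α β hα hβ d hd
  limit x hx y hy := GeneratedSeq.limit x hx y hy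
  norm _ hx := 
    isRecursiveReal_iff.1 (IsRecursiveDiagonal.norm hs (GeneratedSeq.isRecursiveDiagonal hs hx))

theorem mem_computableElements_generatedStructure {E : Type*} [NormedAddCommGroup E]
    [NormedSpace ℂ E] {G : Set E} {g : E} (hg : g ∈ G) :
    g ∈ computableElements (generatedStructure G) :=
  GeneratedSeq.const g hg

end Hilbert

/-- The members of an orthonormal family in a separable space are countably many. -/
theorem Orthonormal.countable_of_separableSpace {H ι : Type*} [NormedAddCommGroup H]
    [InnerProductSpace ℂ H] [TopologicalSpace.SeparableSpace H] {v : ι → H}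
    (hv : Orthonormal ℂ v) : Countable ι := by
  refine Pairwise.countable_of_isOpen_disjoint (s := fun i => Metric.ball (v i) (1 / 2))
    (fun i j hij => Metric.ball_disjoint_ball ?_) (fun i => Metric.isOpen_ball)
    fun i => ⟨v i, Metric.mem_ball_self (by norm_num)⟩
  -- Distinct members lie at distance `√2 > 1`, so their balls of radius `1 / 2` are disjoint.
  have h : ‖v i - v j‖ ^ 2 = 2 := by
    rw [@norm_sub_sq ℂ, hv.1, hv.1, hv.2 hij]
    norm_num
  rw [dist_eq_norm]
  nlinarith [norm_nonneg (v i - v j)]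

/-! ## The exponentials -/

/-- The integral over `[0, T]` is bounded by `2 / |l|` for all `T > 0`, so the average decays like
`1 / T`. -/
theorem tendsto_avg_exp_of_ne_zero {l : ℝ} (hl : l ≠ 0) :
    Tendsto (avg (expFun l)) atTop (𝓝 0) := by
  have hc : (l : ℂ) * Complex.I ≠ 0 := by simp [hl]
  refine squeeze_zero_norm' (a := fun T : ℝ => T⁻¹ * (2 / |l|)) ?_
    (by simpa using tendsto_inv_atTop_zero.mul_const (2 / |l|))
  filter_upwards [eventually_gt_atTop 0] with T hT
  have key : ∫ t in (0 : ℝ)..T, expFun l t =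
      (Complex.exp (((l * T : ℝ) : ℂ) * Complex.I) - 1) / (l * Complex.I) := by
    have h := integral_exp_mul_complex (a := 0) (b := T) hc
    simp only [Complex.ofReal_zero, mul_zero, Complex.exp_zero] at h
    rw [show ((l * T : ℝ) : ℂ) * Complex.I = l * Complex.I * T by push_cast; ring, ← h]
    refine intervalIntegral.integral_congr fun t _ => ?_
    simp only [expFun, BoundedContinuousFunction.coe_ofNormedAddCommGroup]
    congr 1
    push_cast
    ring
  rw [avg, norm_mul, Complex.norm_real, norm_inv, Real.norm_of_nonneg hT.le, key, norm_div,
    norm_mul, Complex.norm_I, mul_one, Complex.norm_real, Real.norm_eq_abs]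
  gcongr
  refine (norm_sub_le _ _).trans ?_
  rw [Complex.norm_exp_ofReal_mul_I, norm_one]
  norm_num

theorem tendsto_avg_exp_zero : Tendsto (avg (expFun 0)) atTop (𝓝 1) := by
  refine (tendsto_const_nhds (x := (1 : ℂ))).congr' ?_
  filter_upwards [eventually_gt_atTop 0] with T hT
  have : (T : ℂ) ≠ 0 := by exact_mod_cast hT.ne'
  simp [avg, expFun, this]

theorem conj_expFun_mul (l m t : ℝ) :
    starRingEnd ℂ (expFun l t) * expFun m t = expFun (m - l) t := by
  simp only [expFun, BoundedContinuousFunction.coe_ofNormedAddCommGroup]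
  rw [← Complex.exp_conj, ← Complex.exp_add]
  congr 1
  simp
  ring

theorem inner_apExp (l m : ℝ) : inner ℂ (apExp l) (apExp m) = if l = m then (1 : ℂ) else 0 := by
  rw [apExp, apExp, UniformSpace.Completion.inner_coe]
  refine tendsto_nhds_unique (tendsto_meanInner (AP.exp l) (AP.exp m)) ?_
  have h : (fun t => starRingEnd ℂ (AP.exp l t) * AP.exp m t) = expFun (m - l) :=
    funext (conj_expFun_mul l m)
  rw [h]
  split_ifs with hlm
  · rw [hlm, sub_self]
    exact tendsto_avg_exp_zero
  · exact tendsto_avg_exp_of_ne_zero (sub_ne_zero.2 (Ne.symm hlm))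

theorem orthonormal_apExp : Orthonormal ℂ apExp := by
  classical
  exact orthonormal_iff_ite.2 inner_apExp

/-- The mean square norm is bounded by the sup norm. -/
theorem AP.norm_le_of_forall_norm_le {f : AP} {C : ℝ} (hC : 0 ≤ C) (h : ∀ t, ‖f t‖ ≤ C) :
    ‖f‖ ≤ C := by
  refine le_of_sq_le_sq ?_ hC
  have h0 : ‖f‖ ^ 2 = ‖meanInner f f‖ := by
    have : inner ℂ f f = meanInner f f := rfl
    rw [← this, inner_self_eq_norm_sq_to_K]
    simp
  rw [h0]
  refine le_of_tendsto (tendsto_meanInner f f).norm ?_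
  filter_upwards [eventually_gt_atTop 0] with T hT
  refine norm_avg_le (fun t => ?_) hT
  rw [Complex.conj_mul', norm_pow, Complex.norm_real, norm_norm]
  exact pow_le_pow_left₀ (norm_nonneg _) (h t) 2

/-- Trigonometric polynomials approximate `f` uniformly, and the sup norm dominates the mean square
norm. -/
theorem coe_mem_closure_span_range_apExp (f : AP) :
    (f : APSpace) ∈ closure (Submodule.span ℂ (Set.range apExp) : Set APSpace) := by
  rw [Metric.mem_closure_iff]
  intro ε hε
  obtain ⟨g, hg, hfg⟩ := Metric.mem_closure_iff.1 f.2 (ε / 2) (by positivity)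
  -- `AP` carries another norm than the bounded functions, so trigonometric polynomials are first
  -- lifted to it.
  have hspan : ∀ g ∈ Submodule.span ℂ (Set.range expFun), ∃ G : AP, G.1 = g ∧
      (G : APSpace) ∈ Submodule.span ℂ (Set.range apExp) := by
    intro g hg
    induction hg using Submodule.span_induction with
    | mem g hg =>
      obtain ⟨l, rfl⟩ := hg
      exact ⟨AP.exp l, rfl, Submodule.subset_span ⟨l, rfl⟩⟩
    | zero => exact ⟨0, rfl, by rw [UniformSpace.Completion.coe_zero]; exact zero_mem _⟩
    | add g h _ _ ihg ihh =>
      obtain ⟨G, rfl, hG⟩ := ihg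
      obtain ⟨K, rfl, hK⟩ := ihh
      exact ⟨G + K, rfl, by rw [UniformSpace.Completion.coe_add]; exact add_mem hG hK⟩
    | smul c g _ ih =>
      obtain ⟨G, rfl, hG⟩ := ih
      exact ⟨c • G, rfl, by
        rw [UniformSpace.Completion.coe_smul]; exact Submodule.smul_mem _ _ hG⟩
  obtain ⟨G, rfl, hG⟩ := hspan g hg
  refine ⟨G, hG, ?_⟩
  rw [dist_eq_norm, ← UniformSpace.Completion.coe_sub, UniformSpace.Completion.norm_coe]
  refine (AP.norm_le_of_forall_norm_le (by positivity : (0 : ℝ) ≤ ε / 2) fun t => ?_).trans_lt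
    (half_lt_self hε)
  rw [dist_eq_norm] at hfg
  exact ((f.1 - G.1).norm_coe_le_norm t).trans hfg.le

theorem topologicalClosure_span_range_apExp :
    (Submodule.span ℂ (Set.range apExp)).topologicalClosure = ⊤ := by
  rw [Submodule.eq_top_iff']
  intro x
  refine UniformSpace.Completion.induction_on x
    (Submodule.isClosed_topologicalClosure _) coe_mem_closure_span_range_apExp

theorem theorem47 :
    ¬ TopologicalSpace.SeparableSpace APSpace ∧
    Orthonormal ℂ apExp ∧
    (Submodule.span ℂ (Set.range apExp)).topologicalClosure = ⊤ ∧
    (∀ s : Set APSpace, s.Nonempty → Orthonormal ℂ (Subtype.val : s → APSpace) →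
      IsComputabilityStructure (generatedStructure (lineProj '' s))) ∧
    IsComputabilityStructure (generatedStructure (Set.range fun lam : ℝ => lineProj (apExp lam))) ∧
    (∀ lam : ℝ, lineProj (apExp lam) ∈ computableElements
      (generatedStructure (Set.range fun lam : ℝ => lineProj (apExp lam)))) ∧
    ¬ (computableElements
      (generatedStructure (Set.range fun lam : ℝ => lineProj (apExp lam)))).Countable := by
  have hon := orthonormal_apExp
  have hrange : Orthonormal ℂ (Subtype.val : Set.range apExp → APSpace) := hon.toSubtypeRange
  have hunc : ¬ Countable ℝ := fun h =>
    Cardinal.not_countable_real (Set.countable_univ_iff.2 h)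
  have hmem : ∀ lam : ℝ, lineProj (apExp lam) ∈ computableElements
      (generatedStructure (Set.range fun lam : ℝ => lineProj (apExp lam))) := fun lam =>
    mem_computableElements_generatedStructure ⟨lam, rfl⟩
  have hstruct : ∀ s : Set APSpace, s.Nonempty → Orthonormal ℂ (Subtype.val : s → APSpace) →
      IsComputabilityStructure (generatedStructure (lineProj '' s)) := fun s hne hs =>
    isComputabilityStructure_generatedStructure hs hne
  refine ⟨fun _ => hunc hon.countable_of_separableSpace, hon, topologicalClosure_span_range_apExp,
    hstruct, ?_, hmem, fun hc => hunc ?_⟩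
  · have h := hstruct _ (Set.range_nonempty apExp) hrange
    rwa [← Set.range_comp] at h
  -- Equal projections force equal unit vectors of the orthonormal set, and `apExp` is injective by
  -- linear independence.
  · have hinj : Function.Injective fun lam : ℝ => lineProj (apExp lam) := fun l m h =>
      hon.linearIndependent.injective
        (projLine_injOn hrange (Set.mem_range_self l) (Set.mem_range_self m) h)
    have := (hc.mono (Set.range_subset_iff.2 hmem)).to_subtype
    exact (Set.rangeFactorization_injective.2 hinj).countable

end
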